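/- **Conventions.** For $m\ge 1$ put $t_i^{m}=-1+\frac{2i}{m+1}$ $(1\le i\le m)$. For $0\le p<n$ let $e^m=(e^m_1,\dots,e^m_m):\coprod_1^m\mathbb R^p\to\mathbb R^n$, $e^m_i(x)=(t_i^m,0,\dots,0,x_1,\dots,x_p)$. Let $\mathcal L_{m\cdot p}^n$ be the space of long links: smooth embeddings $f=(f_1,\dots,f_m):\coprod_1^m\mathbb R^p\to\mathbb R^n$ that map $\coprod_1^m(-1,1)^p$ into $(-1,1)^n$ and agree with $e^m$ outside $\coprod_1^m(-1,1)^p$, with the $C^\infty$ topology and basepoint $e^m$. Let $\Omega\mathcal L_{m\cdot p}^n$ be the space of smooth loops, i.e. of families $\omega=(\omega_t)_{t\in\mathbb R}$ in $\mathcal L_{m\cdot p}^n$ for which $(t,x)\mapsto\omega_t(x)$ is smooth and $\omega_t=e^m$ for $t\notin[-1,1]$, with the $C^\infty$ topology. The graphing map $G:\Omega\mathcal L_{m\cdot p}^n\to\mathcal L_{m\cdot(p+1)}^{n+1}$ is $G(\omega)_i(x_1,\dots,x_{p+1})=\big((\omega_{x_{p+1}})_i(x_1,\dots,x_p),\,x_{p+1}\big)$.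 **Joining data.** Let $m\ge2$ and $c\ge 2$. Write points of $\mathbb R^{c+1}$ as $(x_1,\dots,x_c,y)$, and let $\ell_i=\{(t_i^m,0,\dots,0,y):y\in\mathbb R\}$. Joining data for $(m,c)$ consist of the following. * Numbers $0<\varepsilon<1/m$ and $k>2$, and a smooth coordinate system (a diffeomorphism $\Psi$ between open sets) $\Psi(u,v)$, $u\in\mathbb R$, $v\in\mathbb R^c$, of an open subset of $\mathbb R^{c+1}$, whose domain contains $[0,1]\times\{|v|\le1+\varepsilon\}$. It is a framed tubular neighbourhood of the path $\gamma(u)=\Psi(u,0)$, $0\le u\le 1$. For $|w|\le1$, $\Psi(0,(0,\dots,0,w))=(t_m^m,0,\dots,0,w)$ and $\Psi(1,(0,\dots,0,w))=(t_{m-1}^m,0,\dots,0,k+w)$; and $\gamma'(0),\gamma'(1)$ have last coordinate $0$. * Let $H=\{\Psi(u,(0,\dots,0,w)):0\le u\le 1,\ |w|\le 1\}$ and let $N$ be the set of points at distance at most $\varepsilon$ from $H$. Then $N$ lies in the image of $\Psi$; both $N$ and $\Psi\big((0,1)\times\{|v|<1+\varepsilon\}\big)$ lie in $[-1,1]\times[-2k,2k]^c$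 and miss $[-1,t_{m-1}^m+\varepsilon]\times[-1,1]^c$; and the second set misses $\ell_1,\dots,\ell_{m-1}$. If $\Psi(u,v)\in N\cap[-1,1]^{c+1}$ and $\Psi(u',v)\in N\cap(\ell_1\cup\dots\cup\ell_{m-1})$, then $u'=1$ and $v=(0,\dots,0,w)$ with $|w|\le1$. * A smooth diffeotopy $\varphi_s$, $0\le s\le1$, of $\mathbb R^{c+1}$ with $\varphi_0=\mathrm{id}$ and $\varphi_s=\mathrm{id}$ outside $N$; with $\varphi_s(\Psi(u,(0,\dots,0,w)))=\Psi(u+s,(0,\dots,0,w))$ if $u,s\ge0$, $u+s\le 1$, $|w|\le 1$; and such that for $\Psi(u,v)\in N$ one has $\varphi_s(\Psi(u,v))=\Psi(u',v)$ for some $u'\in[u,u+s]$. * An increasing diffeomorphism $S$ of $\mathbb R$ with $S((-1,1))\subset(-1,1)$ and $S(t_i^m)=t_i^{m-1}$ for $1\le i\le m-1$. **Joining.** Fix joining data for $(m,c)$. For all $p\ge1$ and $n=p+c$ and $f\in\mathcal L_{m\cdot p}^n$, define $\tilde f=(\tilde f_1,\dots,\tilde f_{m-1})$ by $\tilde f_i=(\varphi_1\times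 1_{p-1})\circ f_i$ on $[-1,1]^p$; $\tilde f_{m-1}=(\varphi_1\times1_{p-1})\circ f_m\circ T$ on $[k-1,k+1]\times[-1,1]^{p-1}$, where $T(x)=(x_1-k,x_2,\dots,x_p)$; and $\tilde f_i=e^m_i$ elsewhere. Put $J(f)_i=\big((S,\tfrac1{2k},\dots,\tfrac1{2k})\times1_{p-1}\big)\circ\tilde f_i\circ(2k\times 1_{p-1})$, with $c$ factors $\tfrac1{2k}$. **Proposition.** Let $m\ge2$ and $1\le p\le n-2$, and fix any joining data for $(m,n-p)$; use them for joining both in $\mathbb R^n$ and in $\mathbb R^{n+1}$. Then $J$ defines continuous maps $\mathcal L_{m\cdot p}^n\to\mathcal L_{(m-1)\cdot p}^n$ and $\mathcal L_{m\cdot(p+1)}^{n+1}\to\mathcal L_{(m-1)\cdot(p+1)}^{n+1}$, applying $J$ to each $\omega_t$ defines a continuous map $\Omega J:\Omega\mathcal L_{m\cdot p}^n\to\Omega\mathcal L_{(m-1)\cdot p}^n$, the graphing maps $G$ on $\Omega\mathcal L_{m\cdot p}^n$ and $\Omega\mathcal L_{(m-1)\cdot p}^n$ are well defined and continuous, and $J\circ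 G=G\circ\Omega J$ as maps $\Omega\mathcal L_{m\cdot p}^n\to\mathcal L_{(m-1)\cdot(p+1)}^{n+1}$. In particular $J\circ G$ and $G\circ\Omega J$ are homotopic. -/

import Mathlib

open Set Topology
open scoped ContDiff

noncomputable section

namespace LongLinks

/-- Euclidean space `ℝ^n`. -/
abbrev E (n : ℕ) : Type := EuclideanSpace ℝ (Fin n)

/-! ### Spaces of smooth maps -/

/-- Smooth maps between normed spaces. -/
structure SmoothMap (V W : Type) [NormedAddCommGroup V] [NormedSpace ℝ V]
    [NormedAddCommGroup W] [NormedSpace ℝ W] where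
  toFun : V → W
  smooth : ContDiff ℝ ∞ toFun

/-- The `k`-th derivative of a smooth map, as a continuous map. -/
def SmoothMap.jet {V W : Type} [NormedAddCommGroup V] [NormedSpace ℝ V]
    [NormedAddCommGroup W] [NormedSpace ℝ W] (k : ℕ) (f : SmoothMap V W) :
    C(V, V [×k]→L[ℝ] W) :=
  ⟨iteratedFDeriv ℝ k f.toFun, f.smooth.continuous_iteratedFDeriv (by exact_mod_cast le_top)⟩

/-- The `C^∞` topology: uniform convergence of every derivative on compact sets.
It is used below only on families of maps that all agree outside a fixed cube `[-1,1]^N`; on such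
a family it coincides with the strong (Whitney) `C^∞` topology. -/
instance {V W : Type} [NormedAddCommGroup V] [NormedSpace ℝ V]
    [NormedAddCommGroup W] [NormedSpace ℝ W] : TopologicalSpace (SmoothMap V W) :=
  ⨅ k : ℕ, TopologicalSpace.induced (SmoothMap.jet k) inferInstance

/-! ### Long links -/

/-- `t_i^* = -1 + 2 i / (m + 1)`, for `i = 1, …, m`. -/
def tstar (m i : ℕ) : ℝ := -1 + 2 * (i : ℝ) / ((m : ℝ) + 1)

/-- The standard link: `e_i (x_1, …, x_p) = (t_i^*, 0, …, 0, x_1, …, x_p)`. The components are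
indexed by `Fin m`, so the component `i : Fin m` is the `(i + 1)`-st one. -/
def stdLink (m p n : ℕ) (i : Fin m) (x : E p) : E n :=
  WithLp.toLp 2 fun j : Fin n =>
    if h : n ≤ (j : ℕ) + p then x ⟨(j : ℕ) + p - n, by have := j.isLt; omega⟩
    else if (j : ℕ) = 0 then tstar m ((i : ℕ) + 1) else 0

/-- Long links `∐_1^m ℝ^p → ℝ^n`: smooth embeddings that map the open cubes `(-1,1)^p` into
`(-1,1)^n` and agree with the standard link outside of the open cubes. -/
structure IsLongLink (m p n : ℕ) (f : Fin m → E p → E n) : Prop where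
  smooth : ∀ i, ContDiff ℝ ∞ (f i)
  immersion : ∀ i x, Function.Injective (fderiv ℝ (f i) x)
  embedding : IsEmbedding (fun q : (_ : Fin m) × E p => f q.1 q.2)
  cube : ∀ i x, (∀ j, |x j| < 1) → ∀ j, |f i x j| < 1
  std : ∀ i x, ¬ (∀ j, |x j| < 1) → f i x = stdLink m p n i x

/-- The space `𝓛_{m·p}^n` of long links. -/
structure LongLink (m p n : ℕ) where
  toFun : Fin m → E p → E n
  isLongLink : IsLongLink m p n toFun

/-- A component of a long link. -/
def LongLink.component {m p n : ℕ} (i : Fin m) (f : LongLink m p n) : SmoothMap (E p) (E n) :=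
  ⟨f.toFun i, f.isLongLink.smooth i⟩

instance (m p n : ℕ) : TopologicalSpace (LongLink m p n) :=
  ⨅ i : Fin m, TopologicalSpace.induced (LongLink.component i) inferInstance

/-- The space `Ω 𝓛_{m·p}^n` of smooth loops in `𝓛_{m·p}^n`: smooth families, parametrized by `ℝ`,
that are constant at the standard link outside of `[-1,1]`. -/
structure LoopLink (m p n : ℕ) where
  link : ℝ → LongLink m p n
  smooth : ∀ i, ContDiff ℝ ∞ (fun q : ℝ × E p => (link q.1).toFun i q.2)
  based : ∀ t, t ∉ Icc (-1 : ℝ) 1 → (link t).toFun = stdLink m p n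

/-- A component of a loop of long links, as a smooth map `ℝ × ℝ^p → ℝ^n`. -/
def LoopLink.component {m p n : ℕ} (i : Fin m) (l : LoopLink m p n) :
    SmoothMap (ℝ × E p) (E n) :=
  ⟨fun q => (l.link q.1).toFun i q.2, l.smooth i⟩

instance (m p n : ℕ) : TopologicalSpace (LoopLink m p n) :=
  ⨅ i : Fin m, TopologicalSpace.induced (LoopLink.component i) inferInstance

/-! ### Graphing -/

/-- The graphing map:
`G(ω)_i (x_1, …, x_{p+1}) = (ω_i(x_{p+1})(x_1, …, x_p), x_{p+1})`. -/
def graphFun {m p n : ℕ} (l : LoopLink m p n) (i : Fin m) (x : E (p + 1)) : E (n + 1) :=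
  WithLp.toLp 2 (Fin.snoc (α := fun _ => ℝ)
    (fun j : Fin n =>
      (l.link (x (Fin.last p))).toFun i (WithLp.toLp 2 fun a : Fin p => x a.castSucc) j)
    (x (Fin.last p)))

/-! ### Joining the last two components -/

/-- The point `(a, 0, …, 0, y)` of `ℝ^{c+1}`. For `a = t_i^*` and `y ∈ ℝ` these points form the
`i`-th component of the standard link of one-dimensional components in `ℝ^{c+1}`. -/
def linePoint (c : ℕ) (a y : ℝ) : E (c + 1) :=
  WithLp.toLp 2 fun j : Fin (c + 1) =>
    if (j : ℕ) = c then y else if (j : ℕ) = 0 then a else 0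

/-- The vector `(0, …, 0, w)` of `ℝ^c`. -/
def axis (c : ℕ) (w : ℝ) : E c :=
  WithLp.toLp 2 fun j : Fin c => if (j : ℕ) + 1 = c then w else 0

/-- The box `[-1,1] × [-2k,2k]^c` in `ℝ^{c+1}`. -/
def box (c : ℕ) (k : ℝ) : Set (E (c + 1)) :=
  {x | ∀ j : Fin (c + 1), if (j : ℕ) = 0 then |x j| ≤ 1 else |x j| ≤ 2 * k}

/-- The block `[-1, t_{m-1}^* + ε] × [-1,1]^c` in `ℝ^{c+1}`. -/
def block (m c : ℕ) (ε : ℝ) : Set (E (c + 1)) :=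
  {x | (∀ j, |x j| ≤ 1) ∧ x 0 ≤ tstar m (m - 1) + ε}

/-- The first `m - 1` components of the standard link of one-dimensional components in
`ℝ^{c+1}`. -/
def lines (m c : ℕ) : Set (E (c + 1)) :=
  {x | ∃ i : ℕ, 1 ≤ i ∧ i ≤ m - 1 ∧ ∃ y : ℝ, x = linePoint c (tstar m i) y}

/-- The strip swept out, in framing coordinates, by `[0,1] × 0^{c-1} × [-1,1]`. -/
def strip {c : ℕ} (frame : ℝ × E c → E (c + 1)) : Set (E (c + 1)) :=
  {x | ∃ u ∈ Icc (0 : ℝ) 1, ∃ w ∈ Icc (-1 : ℝ) 1, x = frame (u, axis c w)}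

/-- The auxiliary data for joining the last two of `m` components of codimension `c`. -/
structure JoiningData (m c : ℕ) where
  ε : ℝ
  ε_pos : 0 < ε
  ε_lt : ε < 1 / (m : ℝ)
  k : ℝ
  two_lt_k : 2 < k
  /-- The framed tubular neighbourhood of the path `γ u = frame (u, 0)`, `0 ≤ u ≤ 1`, as a smooth
  coordinate system of `ℝ^{c+1}`: the first coordinate is the parameter of the path, the other `c`
  are the coordinates given by the framing. -/
  frame : OpenPartialHomeomorph (ℝ × E c) (E (c + 1))
  frame_smooth : ContDiffOn ℝ ∞ frame frame.source
  frame_symm_smooth : ContDiffOn ℝ ∞ frame.symm frame.target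
  /-- In the framing coordinates the tubular neighbourhood has radius `1 + ε`. -/
  tube_source : Icc (0 : ℝ) 1 ×ˢ Metric.closedBall (0 : E c) (1 + ε) ⊆ frame.source
  /-- The points within `ε` of the strip lie in the domain of the coordinate system. -/
  near_target : Metric.cthickening ε (strip frame) ⊆ frame.target
  /-- The framing over the initial point `P = (t_m^*, 0, …, 0)` of the path. -/
  frame_start : ∀ w ∈ Icc (-1 : ℝ) 1, frame (0, axis c w) = linePoint c (tstar m m) w
  /-- The framing over the final point `Q = (t_{m-1}^*, 0, …, 0, k)` of the path. -/
  frame_end : ∀ w ∈ Icc (-1 : ℝ) 1,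
    frame (1, axis c w) = linePoint c (tstar m (m - 1)) (k + w)
  /-- The velocity of the path at both ends is orthogonal to the last coordinate axis. -/
  velocity_start : deriv (fun u : ℝ => frame (u, 0) (Fin.last c)) 0 = 0
  velocity_end : deriv (fun u : ℝ => frame (u, 0) (Fin.last c)) 1 = 0
  /-- The interior of the tubular neighbourhood lies in the box and misses the block and the first
  `m - 1` standard components. -/
  tube_subset : frame '' (Ioo (0 : ℝ) 1 ×ˢ Metric.ball (0 : E c) (1 + ε)) ⊆
    box c k \ (block m c ε ∪ lines m c)
  /-- The points within `ε` of the strip lie in the box and miss the block. -/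
  near_subset : Metric.cthickening ε (strip frame) ⊆ box c k \ block m c ε
  /-- A line of constant framing coordinates that meets the cube `[-1,1]^{c+1}` (close to the
  strip) can meet the first `m - 1` standard components (close to the strip) only over the end
  point of the path, and then it is one of the lines that make up the strip. -/
  clean : ∀ (u u' : ℝ) (v : E c), (u, v) ∈ frame.source → (u', v) ∈ frame.source →
    frame (u, v) ∈ Metric.cthickening ε (strip frame) → (∀ j, |frame (u, v) j| ≤ 1) →
    frame (u', v) ∈ Metric.cthickening ε (strip frame) → frame (u', v) ∈ lines m c →
    u' = 1 ∧ ∃ w ∈ Icc (-1 : ℝ) 1, v = axis c w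
  /-- The diffeotopy `φ_s`, `0 ≤ s ≤ 1`. -/
  φ : ℝ → E (c + 1) → E (c + 1)
  φ_smooth : ContDiffOn ℝ ∞ (fun q : ℝ × E (c + 1) => φ q.1 q.2) (Icc (0 : ℝ) 1 ×ˢ univ)
  φ_diffeo : ∀ s ∈ Icc (0 : ℝ) 1, ∃ ψ : E (c + 1) → E (c + 1), ContDiff ℝ ∞ ψ ∧
    Function.LeftInverse ψ (φ s) ∧ Function.RightInverse ψ (φ s)
  φ_zero : ∀ x, φ 0 x = x
  /-- On the strip, `φ_s` flows along the path. -/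
  φ_strip : ∀ u s w : ℝ, 0 ≤ u → 0 ≤ s → u + s ≤ 1 → w ∈ Icc (-1 : ℝ) 1 →
    φ s (frame (u, axis c w)) = frame (u + s, axis c w)
  /-- `φ_s` is supported within `ε` of the strip. -/
  φ_support : ∀ s ∈ Icc (0 : ℝ) 1, ∀ x ∉ Metric.cthickening ε (strip frame), φ s x = x
  /-- Within `ε` of the strip, `φ_s` interpolates between the flow along the path and the
  identity: it preserves the framing coordinates and moves forward by at most `s`. -/
  φ_near : ∀ s ∈ Icc (0 : ℝ) 1, ∀ (u : ℝ) (v : E c), (u, v) ∈ frame.source →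
    frame (u, v) ∈ Metric.cthickening ε (strip frame) →
    ∃ u' ∈ Icc u (u + s), (u', v) ∈ frame.source ∧ φ s (frame (u, v)) = frame (u', v)
  /-- The rescaling of the first coordinate: an increasing diffeomorphism of `ℝ` that maps `(-1,1)`
  into itself and carries the positions of the first `m - 1` of `m` standard components to those
  of the `m - 1` standard components. -/
  S : ℝ → ℝ
  S_smooth : ContDiff ℝ ∞ S
  S_deriv : ∀ x, 0 < deriv S x
  S_surjective : Function.Surjective S
  S_maps : MapsTo S (Ioo (-1) 1) (Ioo (-1) 1)
  S_std : ∀ i : ℕ, 1 ≤ i → i ≤ m - 1 → S (tstar m i) = tstar (m - 1) i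

/-- `φ × 1 : ℝ^n → ℝ^n`, with `φ` acting on the first `a` coordinates. -/
def prodId {a n : ℕ} (h : a ≤ n) (φ : E a → E a) (y : E n) : E n :=
  WithLp.toLp 2 fun j : Fin n =>
    if hj : (j : ℕ) < a then φ (WithLp.toLp 2 fun l : Fin a => y (Fin.castLE h l)) ⟨j, hj⟩
    else y j

/-- The affine map `T`: subtract `k` from the first coordinate. It takes
`[k-1,k+1] × [-1,1]^{p-1}` onto `[-1,1]^p`. -/
def shift {p : ℕ} (k : ℝ) (x : E p) : E p :=
  WithLp.toLp 2 fun j : Fin p => if (j : ℕ) = 0 then x j - k else x j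

/-- The map `r × 1_{p-1} : ℝ^p → ℝ^p`. -/
def stretch {p : ℕ} (r : ℝ) (x : E p) : E p :=
  WithLp.toLp 2 fun j : Fin p => if (j : ℕ) = 0 then r * x j else x j

/-- The map `(S, 1/r, …, 1/r) × 1 : ℝ^n → ℝ^n`, with `c` factors `1/r`. -/
def shrink {n : ℕ} (c : ℕ) (S : ℝ → ℝ) (r : ℝ) (y : E n) : E n :=
  WithLp.toLp 2 fun j : Fin n =>
    if (j : ℕ) = 0 then S (y j) else if (j : ℕ) < c + 1 then y j / r else y j

open Classical in
/-- The first step of joining: `(φ_1 × 1) ∘ f` on the cubes `[-1,1]^p`; on the last of the `m - 1`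
copies of `ℝ^p` moreover `(φ_1 × 1) ∘ f_m ∘ T` on `[k-1,k+1] × [-1,1]^{p-1}`; and the standard
link `e^m` elsewhere. -/
def joinStep {m c p n : ℕ} (D : JoiningData m c) (h : c + 1 ≤ n) (f : Fin m → E p → E n)
    (i : Fin (m - 1)) (x : E p) : E n :=
  if ∀ j, |x j| ≤ 1 then
    prodId h (D.φ 1) (f (Fin.castLE (Nat.sub_le m 1) i) x)
  else if (i : ℕ) + 1 = m - 1 ∧ ∀ j, |shift D.k x j| ≤ 1 then
    prodId h (D.φ 1) (f ⟨m - 1, by have := i.isLt; omega⟩ (shift D.k x))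
  else stdLink m p n (Fin.castLE (Nat.sub_le m 1) i) x

/-- The joining map `J` on underlying maps. -/
def joinFun {m c p n : ℕ} (D : JoiningData m c) (h : c + 1 ≤ n) (f : Fin m → E p → E n)
    (i : Fin (m - 1)) (x : E p) : E n :=
  shrink c D.S (2 * D.k) (joinStep D h f i (stretch (2 * D.k) x))

end LongLinks

end

/-!
Inside the cube, `φ₁` fixes the first `m - 1` standard components, and along the strip it carries
the last one onto its neighbour. So the first step of joining adds to the standard link the
differences `(φ₁ × 1) ∘ f_i - (φ₁ × 1) ∘ e_i`, and on the last copy of `ℝ^p` also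
`(φ₁ × 1) ∘ f_m ∘ T - (φ₁ × 1) ∘ e_m ∘ T`; each of them vanishes outside of a cube.
Hence each component of the join is a fixed smooth map applied to the point `x` and to the two
values of the link at points depending on `x`. This gives smoothness and continuity, for links as
well as for loops, and, since that map acts trivially on the coordinates beyond the first `c + 1`,
commutation with graphing. The join is injective because the conditions on the tube keep the
displaced components apart; an injective immersion that is standard outside of a compact set is
proper, hence an embedding.
-/

noncomputable section

namespace LongLinks

/-! ### Continuity of operations on spaces of smooth maps -/

namespace SmoothMap

variable {U V W W' : Type} {X : Type*} [NormedAddCommGroup U] [NormedSpace ℝ U]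
  [NormedAddCommGroup V] [NormedSpace ℝ V] [NormedAddCommGroup W] [NormedSpace ℝ W]
  [NormedAddCommGroup W'] [NormedSpace ℝ W'] [TopologicalSpace X]

theorem ext {f g : SmoothMap V W} (h : f.toFun = g.toFun) : f = g := by
  cases f
  cases g
  congr

theorem continuous_jet (k : ℕ) : Continuous (jet k : SmoothMap V W → _) :=
  continuous_iInf_dom continuous_induced_dom

theorem continuous_iteratedFDeriv [LocallyCompactSpace V] (k : ℕ) :
    Continuous fun q : SmoothMap V W × V => iteratedFDeriv ℝ k q.1.toFun q.2 :=
  ((continuous_jet k).comp continuous_fst).eval continuous_snd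

theorem continuous_eval [LocallyCompactSpace V] :
    Continuous fun q : SmoothMap V W × V => q.1.toFun q.2 :=
  ((continuousMultilinearCurryFin0 ℝ V W).continuous.comp (continuous_iteratedFDeriv 0)).congr
    fun _ => by simp

theorem continuous_of_iteratedFDeriv {F : X → SmoothMap V W}
    (h : ∀ k : ℕ, Continuous fun q : X × V => iteratedFDeriv ℝ k (F q.1).toFun q.2) :
    Continuous F :=
  continuous_iInf_rng.2 fun k => continuous_induced_rng.2
    (ContinuousMap.continuous_of_continuous_uncurry _ (h k))

/-- The composite of smooth maps. -/
def comp (g : SmoothMap V W) (f : SmoothMap U V) : SmoothMap U W :=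
  ⟨g.toFun ∘ f.toFun, g.smooth.comp f.smooth⟩

/-- The smooth map into a product with the given components. -/
def prodMk (f : SmoothMap V W) (g : SmoothMap V W') : SmoothMap V (W × W') :=
  ⟨fun x => (f.toFun x, g.toFun x), f.smooth.prodMk g.smooth⟩

-- By the formula of Faà di Bruno, the derivatives of a composite are polynomial in the derivatives
-- of the two factors.
theorem continuous_comp [LocallyCompactSpace U] [LocallyCompactSpace V]
    {G : X → SmoothMap V W} {F : X → SmoothMap U V} (hG : Continuous G) (hF : Continuous F) :
    Continuous fun x => (G x).comp (F x) := by
  refine continuous_of_iteratedFDeriv fun k => ?_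
  have faa_di_bruno (q : X × U) : iteratedFDeriv ℝ k ((G q.1).comp (F q.1)).toFun q.2 =
      ∑ c : OrderedFinpartition k, c.compAlongOrderedFinpartitionL ℝ U V W
        (iteratedFDeriv ℝ c.length (G q.1).toFun ((F q.1).toFun q.2))
        fun i => iteratedFDeriv ℝ (c.partSize i) (F q.1).toFun q.2 :=
    iteratedFDeriv_comp (n := ∞) (G q.1).smooth.contDiffAt (F q.1).smooth.contDiffAt
      (by exact_mod_cast le_top)
  simp only [faa_di_bruno]
  have hF' : Continuous fun q : X × U => (F q.1, q.2) := hF.prodMap continuous_id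
  have hGF : Continuous fun q : X × U => (G q.1, (F q.1).toFun q.2) :=
    (hG.comp continuous_fst).prodMk (continuous_eval.comp hF')
  exact continuous_finsetSum _ fun c _ =>
    ((ContinuousLinearMap.continuous _).comp ((continuous_iteratedFDeriv c.length).comp hGF)).eval
      (continuous_pi fun i => (continuous_iteratedFDeriv (c.partSize i)).comp hF')

theorem continuous_prodMk [LocallyCompactSpace V]
    {F : X → SmoothMap V W} {G : X → SmoothMap V W'} (hF : Continuous F) (hG : Continuous G) :
    Continuous fun x => (F x).prodMk (G x) := by
  refine continuous_of_iteratedFDeriv fun k => ?_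
  have deriv_pair (q : X × V) :
      iteratedFDeriv ℝ k ((F q.1).prodMk (G q.1)).toFun q.2 =
        (iteratedFDeriv ℝ k (F q.1).toFun q.2).prod (iteratedFDeriv ℝ k (G q.1).toFun q.2) :=
    iteratedFDeriv_prodMk (n := ∞) (F q.1).smooth.contDiffAt (G q.1).smooth.contDiffAt
      (by exact_mod_cast le_top)
  simp only [deriv_pair]
  exact (ContinuousMultilinearMap.prodL ℝ (fun _ : Fin k => V) W W').continuous.comp
    (((continuous_iteratedFDeriv k).comp (hF.prodMap continuous_id)).prodMk
      ((continuous_iteratedFDeriv k).comp (hG.prodMap continuous_id)))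

end SmoothMap

section Components

variable {m p n : ℕ} {X : Type*} [TopologicalSpace X]

theorem LongLink.ext {f g : LongLink m p n} (h : f.toFun = g.toFun) : f = g := by
  cases f
  cases g
  congr

theorem LongLink.continuous_component (i : Fin m) :
    Continuous (component i : LongLink m p n → _) :=
  continuous_iInf_dom continuous_induced_dom

theorem LongLink.continuous_of_component {F : X → LongLink m p n}
    (h : ∀ i, Continuous fun x => component i (F x)) : Continuous F :=
  continuous_iInf_rng.2 fun i => continuous_induced_rng.2 (h i)

theorem LoopLink.continuous_component (i : Fin m) :
    Continuous (component i : LoopLink m p n → _) :=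
  continuous_iInf_dom continuous_induced_dom

theorem LoopLink.continuous_of_component {F : X → LoopLink m p n}
    (h : ∀ i, Continuous fun x => component i (F x)) : Continuous F :=
  continuous_iInf_rng.2 fun i => continuous_induced_rng.2 (h i)

end Components

/-! ### Boxes -/

section Boxes

variable {n : ℕ} {r : Fin n → ℝ}

/-- The open box `∏ (-r_j, r_j)`. -/
def openBox (r : Fin n → ℝ) : Set (E n) := {x | ∀ j, |x j| < r j}

/-- The closed box `∏ [-r_j, r_j]`. -/
def closedBox (r : Fin n → ℝ) : Set (E n) := {x | ∀ j, |x j| ≤ r j}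

/-- The open cube `(-1,1)^n`. -/
abbrev openCube (n : ℕ) : Set (E n) := openBox fun _ => 1

/-- The closed cube `[-1,1]^n`. -/
abbrev closedCube (n : ℕ) : Set (E n) := closedBox fun _ => 1

theorem openBox_subset_closedBox : openBox r ⊆ closedBox r := fun _ hx j => (hx j).le

theorem openBox_eq_preimage :
    openBox r = EuclideanSpace.equiv (Fin n) ℝ ⁻¹' univ.pi fun j => Ioo (-r j) (r j) := by
  ext x
  simp [openBox, abs_lt]

theorem closedBox_eq_preimage :
    closedBox r = EuclideanSpace.equiv (Fin n) ℝ ⁻¹' univ.pi fun j => Icc (-r j) (r j) := by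
  ext x
  simp [closedBox, abs_le, -pi_univ_Icc]

theorem isOpen_openBox (r : Fin n → ℝ) : IsOpen (openBox r) := by
  rw [openBox_eq_preimage]
  exact (isOpen_set_pi finite_univ fun _ _ => isOpen_Ioo).preimage
    (EuclideanSpace.equiv (Fin n) ℝ).continuous

theorem isClosed_closedBox (r : Fin n → ℝ) : IsClosed (closedBox r) := by
  rw [closedBox_eq_preimage]
  exact (isClosed_set_pi fun _ _ => isClosed_Icc).preimage
    (EuclideanSpace.equiv (Fin n) ℝ).continuous

theorem isCompact_closedBox (r : Fin n → ℝ) : IsCompact (closedBox r) := by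
  rw [closedBox_eq_preimage]
  exact (EuclideanSpace.equiv (Fin n) ℝ).toHomeomorph.isCompact_preimage.2
    (isCompact_univ_pi fun _ => isCompact_Icc)

theorem interior_closedBox (r : Fin n → ℝ) : interior (closedBox r) = openBox r := by
  rw [openBox_eq_preimage, closedBox_eq_preimage]
  refine ((EuclideanSpace.equiv (Fin n) ℝ).toHomeomorph.preimage_interior _).symm.trans ?_
  simp only [interior_pi_set finite_univ, interior_Icc]
  rfl

theorem closure_openBox (hr : ∀ j, 0 < r j) : closure (openBox r) = closedBox r := by
  rw [openBox_eq_preimage, closedBox_eq_preimage]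
  refine ((EuclideanSpace.equiv (Fin n) ℝ).toHomeomorph.preimage_closure _).symm.trans ?_
  simp only [closure_pi_set, closure_Ioo (neg_lt_self (hr _)).ne]
  rfl

end Boxes

/-! ### Immersions -/

section Immersions

variable {U V W : Type*} [NormedAddCommGroup U] [NormedSpace ℝ U]
  [NormedAddCommGroup V] [NormedSpace ℝ V] [NormedAddCommGroup W] [NormedSpace ℝ W]

theorem injective_fderiv_comp {g : V → W} {f : U → V} {x : U}
    (hg : DifferentiableAt ℝ g (f x)) (hf : DifferentiableAt ℝ f x)
    (hgi : Function.Injective (fderiv ℝ g (f x))) (hfi : Function.Injective (fderiv ℝ f x)) :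
    Function.Injective (fderiv ℝ (g ∘ f) x) := by
  rw [fderiv_comp x hg hf]
  exact hgi.comp hfi

theorem injective_fderiv_of_leftInverse {f : V → W} {g : W → V} (hg : Differentiable ℝ g)
    (hf : Differentiable ℝ f) (h : Function.LeftInverse g f) (x : V) :
    Function.Injective (fderiv ℝ f x) := by
  have hid : (fderiv ℝ g (f x)).comp (fderiv ℝ f x) = .id ℝ V := by
    rw [← fderiv_comp x (hg _) (hf x), h.comp_eq_id, fderiv_id]
  exact Function.LeftInverse.injective fun v => DFunLike.congr_fun hid v

theorem fderiv_eqOn_closure {f g : V → W} (hf : ContDiff ℝ 1 f) (hg : ContDiff ℝ 1 g) {s : Set V}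
    (hs : IsOpen s) (h : EqOn f g s) : EqOn (fderiv ℝ f) (fderiv ℝ g) (closure s) :=
  EqOn.closure (fun _ hx => (h.eventuallyEq_of_mem (hs.mem_nhds hx)).fderiv_eq)
    (hf.continuous_fderiv one_ne_zero) (hg.continuous_fderiv one_ne_zero)

theorem injective_fderiv_of_coordwise {n : ℕ} {σ : Fin n → ℝ → ℝ} {y : E n}
    (hσ : ∀ j, deriv (σ j) (y j) ≠ 0) :
    Function.Injective (fderiv ℝ (fun z : E n => (WithLp.toLp 2 fun j => σ j (z j) : E n)) y) := by
  have hd : HasFDerivAt (fun z : E n => (WithLp.toLp 2 fun j => σ j (z j) : E n))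
      ((EuclideanSpace.equiv (Fin n) ℝ).symm.toContinuousLinearMap.comp
        (.pi fun j => deriv (σ j) (y j) • (EuclideanSpace.proj j : E n →L[ℝ] ℝ))) y :=
    (EuclideanSpace.equiv (Fin n) ℝ).symm.hasFDerivAt.comp y <| hasFDerivAt_pi.2 fun j =>
      (differentiableAt_of_deriv_ne_zero (hσ j)).hasDerivAt.comp_hasFDerivAt y
        (EuclideanSpace.proj j : E n →L[ℝ] ℝ).hasFDerivAt
  rw [hd.fderiv, injective_iff_map_eq_zero]
  intro v hv
  ext j
  have hj := congrArg (fun w : E n => w j) hv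
  simpa [hσ j] using hj

theorem injective_fderiv_graph {F : ℝ × V → W} (hF : Differentiable ℝ F) {t : ℝ} {v : V}
    (h : Function.Injective (fderiv ℝ (fun w => F (t, w)) v)) :
    Function.Injective (fderiv ℝ (fun q : ℝ × V => (q.1, F q)) (t, v)) := by
  have hd : fderiv ℝ (fun q : ℝ × V => (q.1, F q)) (t, v) =
      (ContinuousLinearMap.fst ℝ ℝ V).prod (fderiv ℝ F (t, v)) :=
    (hasFDerivAt_fst.prodMk (hF _).hasFDerivAt).fderiv
  have hslice : fderiv ℝ (fun w => F (t, w)) v =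
      (fderiv ℝ F (t, v)).comp (ContinuousLinearMap.inr ℝ ℝ V) :=
    ((hF (t, v)).hasFDerivAt.comp v (hasFDerivAt_prodMk_right t v)).fderiv
  rw [injective_iff_map_eq_zero] at h ⊢
  rintro ⟨s, w⟩ hsw
  rw [hd, ContinuousLinearMap.prod_apply, Prod.mk_eq_zero] at hsw
  obtain ⟨rfl : s = 0, hw⟩ := hsw
  rw [h w (by rw [hslice]; exact hw), Prod.mk_zero_zero]

end Immersions

/-! ### Proper maps on finite disjoint unions -/

theorem isClosedMap_sigma_of_finite {ι Y : Type*} {X : ι → Type*} [Finite ι]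
    [∀ i, TopologicalSpace (X i)] [TopologicalSpace Y] {f : ∀ i, X i → Y}
    (hf : ∀ i, IsClosedMap (f i)) : IsClosedMap fun q : Sigma X => f q.1 q.2 := by
  intro C hC
  have himage : (fun q : Sigma X => f q.1 q.2) '' C = ⋃ i, f i '' (Sigma.mk i ⁻¹' C) := by
    ext y
    simp only [mem_image, Sigma.exists, mem_iUnion, mem_preimage]
  rw [himage]
  exact isClosed_iUnion_of_finite fun i => hf i _ (hC.preimage continuous_sigmaMk)

theorem isProperMap_of_eqOn_compl {X Y : Type*} [TopologicalSpace X] [TopologicalSpace Y]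
    [T2Space Y] [WeaklyLocallyCompactSpace Y] {f g : X → Y} (hf : Continuous f)
    (hg : IsProperMap g) {K : Set X} (hK : IsCompact K) (h : EqOn f g Kᶜ) : IsProperMap f :=
  isProperMap_iff_tendsto_cocompact.2 ⟨hf, (isProperMap_iff_tendsto_cocompact.1 hg).2.congr' <|
    h.symm.eventuallyEq_of_mem hK.compl_mem_cocompact⟩

/-! ### Linear and coordinatewise maps -/

section ElementaryMaps

variable {m p n a c : ℕ} {S : ℝ → ℝ} {k r : ℝ}

theorem contDiff_coord (j : Fin n) : ContDiff ℝ ∞ fun x : E n => x j :=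
  contDiff_euclidean.1 contDiff_id j

theorem contDiff_stdLink (i : Fin m) : ContDiff ℝ ∞ (stdLink m p n i) := by
  refine contDiff_euclidean.2 fun j => ?_
  simp only [stdLink]
  split_ifs
  exacts [contDiff_coord _, contDiff_const, contDiff_const]

/-- The projection to the first `a` coordinates. -/
def head (h : a ≤ n) (y : E n) : E a :=
  WithLp.toLp 2 fun l : Fin a => y (Fin.castLE h l)

theorem contDiff_head (h : a ≤ n) : ContDiff ℝ ∞ (head h) :=
  contDiff_euclidean.2 fun _ => contDiff_coord _

theorem ext_head (h : a ≤ n) {y z : E n} (hhead : head h y = head h z)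
    (hrest : ∀ j : Fin n, a ≤ (j : ℕ) → y j = z j) : y = z := by
  ext j
  rcases lt_or_ge (j : ℕ) a with hj | hj
  · exact congrArg (fun x : E a => x ⟨j, hj⟩) hhead
  · exact hrest j hj

theorem prodId_apply_of_lt (h : a ≤ n) (φ : E a → E a) (y : E n) {j : Fin n}
    (hj : (j : ℕ) < a) : prodId h φ y j = φ (head h y) ⟨j, hj⟩ := by
  simp [prodId, hj, head]

theorem prodId_apply_of_le (h : a ≤ n) (φ : E a → E a) (y : E n) {j : Fin n}
    (hj : a ≤ (j : ℕ)) : prodId h φ y j = y j := by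
  simp [prodId, not_lt.2 hj]

theorem head_prodId (h : a ≤ n) (φ : E a → E a) (y : E n) :
    head h (prodId h φ y) = φ (head h y) :=
  PiLp.ext fun l => prodId_apply_of_lt h φ y (j := Fin.castLE h l) l.isLt

theorem contDiff_prodId (h : a ≤ n) {φ : E a → E a} (hφ : ContDiff ℝ ∞ φ) :
    ContDiff ℝ ∞ (prodId h φ : E n → E n) := by
  refine contDiff_euclidean.2 fun j => ?_
  simp only [prodId]
  split_ifs with hj
  exacts [(contDiff_coord _).comp (hφ.comp (contDiff_head h)), contDiff_coord j]

theorem prodId_leftInverse (h : a ≤ n) {φ ψ : E a → E a} (hφ : Function.LeftInverse ψ φ) :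
    Function.LeftInverse (prodId h ψ) (prodId h φ) := fun y =>
  ext_head h (by rw [head_prodId, head_prodId, hφ]) fun j hj => by
    rw [prodId_apply_of_le h _ _ hj, prodId_apply_of_le h _ _ hj]

/-- The projection to the last `p` coordinates. -/
def tail (h : p ≤ n) (y : E n) : E p :=
  WithLp.toLp 2 fun l : Fin p => y ⟨(l : ℕ) + (n - p), by omega⟩

theorem contDiff_tail (h : p ≤ n) : ContDiff ℝ ∞ (tail h) :=
  contDiff_euclidean.2 fun _ => contDiff_coord _

theorem tail_stdLink (h : p ≤ n) (i : Fin m) :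
    Function.LeftInverse (tail h) (stdLink m p n i) := by
  intro x
  ext l
  have hl : n ≤ (l : ℕ) + (n - p) + p := by omega
  have hl' : (l : ℕ) + (n - p) + p - n = l := by omega
  simp [tail, stdLink, hl, hl']

theorem isProperMap_stdLink (h : p ≤ n) (i : Fin m) : IsProperMap (stdLink m p n i) :=
  ((tail_stdLink h i).isClosedEmbedding (contDiff_tail h).continuous
    (contDiff_stdLink i).continuous).isProperMap

theorem injective_fderiv_stdLink (h : p ≤ n) (i : Fin m) (x : E p) :
    Function.Injective (fderiv ℝ (stdLink m p n i) x) :=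
  injective_fderiv_of_leftInverse ((contDiff_tail h).differentiable (by simp))
    ((contDiff_stdLink i).differentiable (by simp)) (tail_stdLink h i) x

theorem contDiff_shift (k : ℝ) : ContDiff ℝ ∞ (shift k : E p → E p) := by
  refine contDiff_euclidean.2 fun j => ?_
  simp only [shift]
  split_ifs
  exacts [(contDiff_coord j).sub contDiff_const, contDiff_coord j]

theorem shift_neg_shift (k : ℝ) (x : E p) : shift (-k) (shift k x) = x := by
  ext j
  by_cases hj : (j : ℕ) = 0 <;> simp [shift, hj]

theorem injective_fderiv_shift (k : ℝ) (x : E p) :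
    Function.Injective (fderiv ℝ (shift k : E p → E p) x) :=
  injective_fderiv_of_leftInverse ((contDiff_shift _).differentiable (by simp))
    ((contDiff_shift k).differentiable (by simp)) (shift_neg_shift k) x

theorem contDiff_stretch (r : ℝ) : ContDiff ℝ ∞ (stretch r : E p → E p) := by
  refine contDiff_euclidean.2 fun j => ?_
  simp only [stretch]
  split_ifs
  exacts [contDiff_const.mul (contDiff_coord j), contDiff_coord j]

theorem stretch_leftInverse (hr : r ≠ 0) :
    Function.LeftInverse (stretch r⁻¹) (stretch r : E p → E p) := by
  intro x
  ext j
  by_cases hj : (j : ℕ) = 0 <;> simp [stretch, hj, hr]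

theorem injective_fderiv_stretch (hr : r ≠ 0) (x : E p) :
    Function.Injective (fderiv ℝ (stretch r : E p → E p) x) :=
  injective_fderiv_of_leftInverse ((contDiff_stretch _).differentiable (by simp))
    ((contDiff_stretch r).differentiable (by simp)) (stretch_leftInverse hr) x

theorem contDiff_shrink (hS : ContDiff ℝ ∞ S) : ContDiff ℝ ∞ (shrink c S r : E n → E n) := by
  refine contDiff_euclidean.2 fun j => ?_
  simp only [shrink]
  split_ifs
  exacts [hS.comp (contDiff_coord j), (contDiff_coord j).div_const r, contDiff_coord j]

theorem shrink_injective (hS : Function.Injective S) (hr : r ≠ 0) :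
    Function.Injective (shrink c S r : E n → E n) := by
  intro x y h
  ext j
  have hj : shrink c S r x j = shrink c S r y j := by rw [h]
  simp only [shrink] at hj
  split_ifs at hj
  exacts [hS hj, (div_left_inj' hr).1 hj, hj]

theorem injective_fderiv_shrink (hS : ∀ x, deriv S x ≠ 0) (hr : r ≠ 0) (y : E n) :
    Function.Injective (fderiv ℝ (shrink c S r) y) := by
  let σ (j : Fin n) : ℝ → ℝ :=
    if (j : ℕ) = 0 then S else if (j : ℕ) < c + 1 then (· / r) else id
  have hshrink : shrink c S r = fun z : E n => WithLp.toLp 2 fun j => σ j (z j) := by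
    ext z j
    simp only [shrink, σ]
    split_ifs <;> rfl
  rw [hshrink]
  refine injective_fderiv_of_coordwise fun j => ?_
  simp only [σ]
  split_ifs
  · exact hS _
  · simpa using hr
  · simp

end ElementaryMaps

theorem isEmbedding_of_eqOn_std {m p n : ℕ} (hpn : p ≤ n) {f : Fin m → E p → E n}
    (hf : ∀ i, Continuous (f i)) (hstd : ∀ i, EqOn (f i) (stdLink m p n i) (closedCube p)ᶜ)
    (hinj : Function.Injective fun q : (_ : Fin m) × E p => f q.1 q.2) :
    IsEmbedding fun q : (_ : Fin m) × E p => f q.1 q.2 :=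
  (IsClosedEmbedding.of_continuous_injective_isClosedMap (continuous_sigma hf) hinj <|
    isClosedMap_sigma_of_finite fun i => (isProperMap_of_eqOn_compl (hf i)
      (isProperMap_stdLink hpn i) (isCompact_closedBox _) (hstd i)).isClosedMap).isEmbedding

/-! ### Positions of the standard components -/

section Positions

variable {m i j c : ℕ} {a y : ℝ}

theorem abs_tstar_lt_one (hi : 1 ≤ i) (him : i ≤ m) : |tstar m i| < 1 := by
  have hpos : 0 < 2 * (i : ℝ) / ((m : ℝ) + 1) := by positivity
  have hlt : 2 * (i : ℝ) / ((m : ℝ) + 1) < 2 := by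
    rw [div_lt_iff₀ (by positivity)]
    have : (i : ℝ) ≤ m := by exact_mod_cast him
    linarith
  rw [tstar, abs_lt]
  constructor <;> linarith

theorem tstar_mono (h : i ≤ j) : tstar m i ≤ tstar m j := by
  unfold tstar
  gcongr

theorem tstar_injective (m : ℕ) : Function.Injective (tstar m) := by
  intro i j h
  have hm : (m : ℝ) + 1 ≠ 0 := by positivity
  simpa [tstar, hm] using h

theorem linePoint_last : linePoint c a y (Fin.last c) = y := by
  simp [linePoint]

theorem linePoint_zero (hc : c ≠ 0) : linePoint c a y 0 = a := by
  simp [linePoint, hc.symm]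

theorem linePoint_mem_closedCube (ha : |a| ≤ 1) (hy : |y| ≤ 1) :
    linePoint c a y ∈ closedCube (c + 1) := by
  intro j
  simp only [linePoint]
  split_ifs <;> simp [ha, hy]

end Positions

/-- The half-widths of the box `[-1,1] × [-2k,2k]^c × [-1,1]^{n-c-1}` in `ℝ^n`. -/
def boxWidth (c : ℕ) (k : ℝ) {n : ℕ} (j : Fin n) : ℝ :=
  if (j : ℕ) = 0 then 1 else if (j : ℕ) < c + 1 then 2 * k else 1

theorem box_eq_closedBox (c : ℕ) (k : ℝ) : box c k = closedBox (boxWidth c k) := by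
  ext x
  refine forall_congr' fun j => ?_
  by_cases hj : (j : ℕ) = 0 <;> simp [boxWidth, hj, j.is_le]

/-! ### The time-one map of the diffeotopy -/

namespace JoiningData

variable {m c : ℕ} (D : JoiningData m c)

/-- The neighbourhood `N` of the strip that contains the support of the diffeotopy. -/
abbrev near : Set (E (c + 1)) := Metric.cthickening D.ε (strip D.frame)

theorem φ_one_of_notMem_near {z : E (c + 1)} (hz : z ∉ D.near) : D.φ 1 z = z :=
  D.φ_support 1 (right_mem_Icc.2 zero_le_one) z hz

theorem exists_φ_one_inverse : ∃ ψ : E (c + 1) → E (c + 1), ContDiff ℝ ∞ ψ ∧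
    Function.LeftInverse ψ (D.φ 1) ∧ Function.RightInverse ψ (D.φ 1) :=
  D.φ_diffeo 1 (right_mem_Icc.2 zero_le_one)

theorem contDiff_φ_one : ContDiff ℝ ∞ (D.φ 1) :=
  contDiffOn_univ.1 <| D.φ_smooth.comp (contDiff_prodMk_right (1 : ℝ)).contDiffOn fun _ _ =>
    ⟨right_mem_Icc.2 zero_le_one, mem_univ _⟩

theorem φ_one_injective : Function.Injective (D.φ 1) :=
  let ⟨_, _, hψ, _⟩ := D.exists_φ_one_inverse
  hψ.injective

theorem isOpenMap_φ_one : IsOpenMap (D.φ 1) :=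
  let ⟨_, hψ, hl, hr⟩ := D.exists_φ_one_inverse
  .of_inverse hψ.continuous hr hl

theorem mapsTo_φ_one_near : MapsTo (D.φ 1) D.near D.near := by
  intro z hz
  by_contra h
  rw [D.φ_one_injective (D.φ_one_of_notMem_near h)] at h
  exact h hz

theorem mapsTo_φ_one_openBox :
    MapsTo (D.φ 1) (openBox (boxWidth c D.k)) (openBox (boxWidth c D.k)) := by
  have hbox : MapsTo (D.φ 1) (box c D.k) (box c D.k) := by
    intro z hz
    by_cases hN : z ∈ D.near
    · exact (D.near_subset (D.mapsTo_φ_one_near hN)).1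
    · rwa [D.φ_one_of_notMem_near hN]
  rw [← interior_closedBox, ← box_eq_closedBox]
  exact D.isOpenMap_φ_one.mapsTo_interior hbox

-- In codimension zero the segments over the initial point of the path would be constant.
theorem codim_ne_zero (D : JoiningData m c) : c ≠ 0 := by
  rintro rfl
  have haxis : axis 0 1 = axis 0 (-1) := Subsingleton.elim _ _
  have hline := (D.frame_start 1 (by norm_num)).symm.trans <|
    (congrArg (fun v => D.frame (0, v)) haxis).trans (D.frame_start (-1) (by norm_num))
  have hlast := congrArg (fun x : E 1 => x (Fin.last 0)) hline
  simp only [linePoint_last] at hlast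
  norm_num at hlast

theorem φ_one_linePoint_of_le {i : ℕ} (hi : 1 ≤ i) (him : i ≤ m - 1) {y : ℝ} (hy : |y| ≤ 1) :
    D.φ 1 (linePoint c (tstar m i) y) = linePoint c (tstar m i) y := by
  refine D.φ_one_of_notMem_near fun hN => (D.near_subset hN).2
    ⟨linePoint_mem_closedCube (abs_tstar_lt_one hi (by omega)).le hy, ?_⟩
  rw [linePoint_zero D.codim_ne_zero]
  linarith [tstar_mono (m := m) him, D.ε_pos]

theorem φ_one_linePoint_last {w : ℝ} (hw : |w| ≤ 1) :
    D.φ 1 (linePoint c (tstar m m) w) = linePoint c (tstar m (m - 1)) (D.k + w) := by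
  have hw' : w ∈ Icc (-1 : ℝ) 1 := abs_le.1 hw
  rw [← D.frame_start w hw', D.φ_strip 0 1 w le_rfl zero_le_one (by simp) hw', zero_add,
    D.frame_end w hw']

-- Within `N`, the map `φ_1` preserves the lines of constant framing coordinates, and by `clean`
-- those that meet the cube meet the first `m - 1` standard components only in the strip.
theorem of_φ_one_eq_linePoint {z : E (c + 1)} (hz : z ∈ closedCube (c + 1)) {i : ℕ}
    (hi : 1 ≤ i) (him : i ≤ m - 1) {y : ℝ} (h : D.φ 1 z = linePoint c (tstar m i) y) :
    |y| ≤ 1 ∨ (i = m - 1 ∧ |y - D.k| ≤ 1) := by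
  by_cases hN : z ∈ D.near
  · right
    obtain ⟨⟨u, v⟩, hs, rfl⟩ : ∃ q ∈ D.frame.source, D.frame q = z :=
      ⟨_, D.frame.map_target (D.near_target hN), D.frame.right_inv (D.near_target hN)⟩
    obtain ⟨u', -, hs', hφ⟩ := D.φ_near 1 (right_mem_Icc.2 zero_le_one) u v hs hN
    obtain ⟨rfl, w, hw, rfl⟩ := D.clean u u' v hs hs' hN hz
      (hφ ▸ D.mapsTo_φ_one_near hN) (hφ ▸ ⟨i, hi, him, y, h⟩)
    have hline : linePoint c (tstar m i) y = linePoint c (tstar m (m - 1)) (D.k + w) := by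
      rw [← h, hφ, D.frame_end w hw]
    have hpos := congrArg (fun x : E (c + 1) => x 0) hline
    have hlast := congrArg (fun x : E (c + 1) => x (Fin.last c)) hline
    simp only [linePoint_zero D.codim_ne_zero, linePoint_last] at hpos hlast
    rw [hlast, add_sub_cancel_left]
    exact ⟨tstar_injective m hpos, abs_le.2 hw⟩
  · left
    rw [D.φ_one_of_notMem_near hN] at h
    simpa only [h, linePoint_last] using hz (Fin.last c)

theorem S_injective : Function.Injective D.S :=
  (strictMono_of_deriv_pos D.S_deriv).injective

end JoiningData

/-! ### The standard link in codimension `c` -/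

section Standard

variable {m c p : ℕ} (h : c + 1 ≤ c + (p + 1)) (i : Fin m) (x : E (p + 1))

theorem head_stdLink : head h (stdLink m (p + 1) (c + (p + 1)) i x) =
    linePoint c (tstar m (i + 1)) (x 0) := by
  ext j
  by_cases hj : (j : ℕ) = c
  · simp [head, stdLink, linePoint, hj]
  · have hlt : ¬ c ≤ (j : ℕ) := by omega
    simp [head, stdLink, linePoint, hj, hlt, -Fin.val_eq_zero_iff]

theorem stdLink_natAdd (j : Fin (p + 1)) :
    stdLink m (p + 1) (c + (p + 1)) i x (j.natAdd c) = x j := by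
  have hj : c + j + (p + 1) - (c + (p + 1)) = (j : ℕ) := by omega
  simp [stdLink, hj]

theorem ext_stdLink {y z : E (c + (p + 1))} (hhead : head h y = head h z)
    (hrest : ∀ j : Fin (p + 1), j ≠ 0 → y (j.natAdd c) = z (j.natAdd c)) : y = z := by
  refine ext_head h hhead fun j hj => ?_
  have hpos : (⟨(j : ℕ) - c, by omega⟩ : Fin (p + 1)) ≠ 0 :=
    Fin.val_ne_zero_iff.1 (Nat.sub_ne_zero_of_lt hj)
  have hj' : (⟨(j : ℕ) - c, by omega⟩ : Fin (p + 1)).natAdd c = j := by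
    ext
    exact Nat.add_sub_of_le (by omega)
  simpa only [hj'] using hrest _ hpos

theorem stdLink_sigma_injective (hc : c ≠ 0) : Function.Injective
    fun q : (_ : Fin m) × E (p + 1) => stdLink m (p + 1) (c + (p + 1)) q.1 q.2 := by
  rintro ⟨i, x⟩ ⟨i', x'⟩ he
  have hhead := congrArg (fun y => head (by omega : c + 1 ≤ c + (p + 1)) y 0) he
  simp only [head_stdLink, linePoint_zero hc] at hhead
  obtain rfl : i = i' := Fin.ext (Nat.succ_injective (tstar_injective m hhead))
  exact congrArg (Sigma.mk i) ((tail_stdLink (by omega) i).injective he)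

theorem stdLink_mem_closedCube {m p n : ℕ} {i : Fin m} {x : E p} (hx : x ∈ closedCube p) :
    stdLink m p n i x ∈ closedCube n := by
  intro j
  simp only [stdLink]
  split_ifs
  · exact hx _
  · exact (abs_tstar_lt_one (by omega) i.isLt).le
  · simp

theorem IsLongLink.mem_closedCube {m p n : ℕ} {f : Fin m → E p → E n} (hf : IsLongLink m p n f)
    (i : Fin m) {x : E p} (hx : x ∈ closedCube p) : f i x ∈ closedCube n := by
  by_cases hx' : x ∈ openCube p
  · exact fun j => (hf.cube i x hx' j).le
  · rw [hf.std i x hx']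
    exact stdLink_mem_closedCube hx

end Standard

/-! ### The map `φ_1 × 1` -/

namespace JoiningData

variable {m c n p : ℕ} (D : JoiningData m c)

/-- The map `φ_1 × 1` of `ℝ^n`. -/
abbrev push (h : c + 1 ≤ n) (y : E n) : E n := prodId h (D.φ 1) y

theorem contDiff_push (h : c + 1 ≤ n) : ContDiff ℝ ∞ (D.push h) :=
  contDiff_prodId h D.contDiff_φ_one

theorem push_injective (h : c + 1 ≤ n) : Function.Injective (D.push h) :=
  let ⟨_, _, hψ, _⟩ := D.exists_φ_one_inverse
  (prodId_leftInverse h hψ).injective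

theorem injective_fderiv_push (h : c + 1 ≤ n) (y : E n) :
    Function.Injective (fderiv ℝ (D.push h) y) :=
  let ⟨_, hψ, hl, _⟩ := D.exists_φ_one_inverse
  injective_fderiv_of_leftInverse ((contDiff_prodId h hψ).differentiable (by simp))
    ((D.contDiff_push h).differentiable (by simp)) (prodId_leftInverse h hl) y

theorem mapsTo_push_openBox (h : c + 1 ≤ n) :
    MapsTo (D.push h) (openBox (boxWidth c D.k)) (openBox (boxWidth c D.k)) := by
  intro y hy j
  rcases lt_or_ge (j : ℕ) (c + 1) with hj | hj
  · rw [prodId_apply_of_lt h _ _ hj]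
    exact D.mapsTo_φ_one_openBox (fun l => hy (Fin.castLE h l)) ⟨j, hj⟩
  · rw [prodId_apply_of_le h _ _ hj]
    exact hy j

variable (h : c + 1 ≤ c + (p + 1)) {i i' : Fin m} {x : E (p + 1)}

theorem push_stdLink (hi : (i : ℕ) + 1 ≤ m - 1) (hx : |x 0| ≤ 1) :
    D.push h (stdLink m (p + 1) _ i x) = stdLink m (p + 1) _ i x :=
  ext_head h (by rw [head_prodId, head_stdLink, D.φ_one_linePoint_of_le (by omega) hi hx])
    fun _ hj => prodId_apply_of_le h _ _ hj

theorem push_stdLink_last (hi : (i : ℕ) + 1 = m) (hi' : (i' : ℕ) + 1 = m - 1)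
    (hx : |shift D.k x 0| ≤ 1) :
    D.push h (stdLink m (p + 1) _ i (shift D.k x)) = stdLink m (p + 1) _ i' x := by
  refine ext_stdLink h ?_ fun j hj => ?_
  · rw [head_prodId, head_stdLink, head_stdLink, hi, hi', D.φ_one_linePoint_last hx]
    simp [shift]
  · have hj' : (j : ℕ) ≠ 0 := Fin.val_ne_zero_iff.2 hj
    rw [prodId_apply_of_le h _ _ (by rw [Fin.val_natAdd]; omega), stdLink_natAdd, stdLink_natAdd]
    simp [shift, hj]

theorem of_push_eq_stdLink {y : E (c + (p + 1))} (hy : y ∈ closedCube _)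
    (hi : (i : ℕ) + 1 ≤ m - 1) (hpush : D.push h y = stdLink m (p + 1) _ i x) :
    x ∈ closedCube _ ∨ ((i : ℕ) + 1 = m - 1 ∧ shift D.k x ∈ closedCube _) := by
  have hrest : ∀ j : Fin (p + 1), j ≠ 0 → |x j| ≤ 1 := by
    intro j hj
    have hj' : (j : ℕ) ≠ 0 := Fin.val_ne_zero_iff.2 hj
    rw [← stdLink_natAdd i x j, ← hpush, prodId_apply_of_le h _ _ (by rw [Fin.val_natAdd]; omega)]
    exact hy _
  have hhead := congrArg (head h) hpush
  rw [head_prodId, head_stdLink] at hhead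
  refine (D.of_φ_one_eq_linePoint (fun j => hy _) (by omega) hi hhead).imp
    (fun hx j => ?_) fun hx => ⟨hx.1, fun j => ?_⟩
  · rcases eq_or_ne j 0 with rfl | hj
    exacts [hx, hrest j hj]
  · rcases eq_or_ne j 0 with rfl | hj
    · simpa [shift] using hx.2
    · simpa [shift, hj] using hrest j hj

end JoiningData

/-! ### The first step of joining -/

/-- The index of the component of an `m`-component link that becomes the component `i` of its
join. -/
abbrev keptIndex {m : ℕ} (i : Fin (m - 1)) : Fin m := Fin.castLE (Nat.sub_le m 1) i

/-- The index of the last component of an `m`-component link; the argument shows that `0 < m`. -/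
abbrev lastIndex {m : ℕ} (i : Fin (m - 1)) : Fin m := ⟨m - 1, by have := i.isLt; omega⟩

namespace JoiningData

variable {m c n p : ℕ} (D : JoiningData m c)

/-- The point `x` of the standard component `i`, displaced as prescribed by the points `y` of the
kept component and `z` of the last component. On links that are standard outside of the cubes this
is the first step of joining, in a form that is smooth in all variables. -/
def glue (h : c + 1 ≤ n) (i : Fin (m - 1)) (x : E p) (y z : E n) : E n :=
  stdLink m p n (keptIndex i) x +
    (D.push h y - D.push h (stdLink m p n (keptIndex i) x)) +
    if (i : ℕ) + 1 = m - 1 then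
      D.push h z - D.push h (stdLink m p n (lastIndex i) (shift D.k x))
    else 0

theorem contDiff_glue (h : c + 1 ≤ n) (i : Fin (m - 1)) :
    ContDiff ℝ ∞ fun q : E p × E n × E n => D.glue h i q.1 q.2.1 q.2.2 := by
  have hpush := D.contDiff_push h
  have hstd (i : Fin m) : ContDiff ℝ ∞ (stdLink m p n i) := contDiff_stdLink i
  have hshift : ContDiff ℝ ∞ (shift D.k : E p → E p) := contDiff_shift D.k
  simp only [glue]
  split_ifs <;> fun_prop

theorem shift_notMem_openCube {x : E (p + 1)} (hx : x ∈ closedCube _) :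
    shift D.k x ∉ openCube _ := by
  intro hshift
  have hupper := (abs_le.1 (hx 0)).2
  have hlower := (abs_lt.1 (hshift 0)).1
  simp only [shift, Fin.val_zero, if_true] at hlower
  linarith [D.two_lt_k]

theorem shift_k_injective : Function.Injective (shift D.k : E p → E p) :=
  Function.LeftInverse.injective (shift_neg_shift D.k)

theorem closure_shift_preimage_openCube :
    closure (shift D.k ⁻¹' openCube p) = shift D.k ⁻¹' closedCube p := by
  let e : E p ≃ₜ E p :=
    { toFun := shift D.k
      invFun := shift (-D.k)
      left_inv := shift_neg_shift D.k
      right_inv := fun x => by simpa only [neg_neg] using shift_neg_shift (-D.k) x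
      continuous_toFun := (contDiff_shift _).continuous
      continuous_invFun := (contDiff_shift _).continuous }
  exact (e.preimage_closure _).symm.trans (congrArg _ (closure_openBox fun _ => one_pos))

section LongLink

variable (h : c + 1 ≤ c + (p + 1)) {f : Fin m → E (p + 1) → E (c + (p + 1))}
  (hf : IsLongLink m (p + 1) (c + (p + 1)) f) (i : Fin (m - 1)) {x : E (p + 1)}

include hf

theorem joinStep_eq_glue (x : E (p + 1)) : joinStep D h f i x =
    D.glue h i x (f (keptIndex i) x) (f (lastIndex i) (shift D.k x)) := by
  have hm : m - 1 + 1 = m := by have := i.isLt; omega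
  have hstd {j : Fin m} {y : E (p + 1)} (hy : y ∉ closedCube _) : f j y = stdLink m _ _ j y :=
    hf.std j y fun hy' => hy (openBox_subset_closedBox hy')
  unfold joinStep glue
  split_ifs with hx hlast hmoved hlast hlast
  · rw [hf.std _ _ (D.shift_notMem_openCube hx), D.push_stdLink h (by simp) (hx 0)]
    abel
  · rw [D.push_stdLink h (by simp) (hx 0)]
    abel
  · rw [hstd hx, D.push_stdLink_last h (i' := keptIndex i) hm hlast (hmoved.2 0)]
    abel
  · exact absurd hmoved.1 hlast
  · rw [hstd hx, hstd fun hmem => hmoved ⟨hlast, hmem⟩]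
    abel
  · rw [hstd hx]
    abel

theorem contDiff_joinStep : ContDiff ℝ ∞ (joinStep D h f i) := by
  rw [funext (D.joinStep_eq_glue h hf i)]
  exact (D.contDiff_glue h i).comp <| contDiff_id.prodMk <|
    (hf.smooth _).prodMk ((hf.smooth _).comp (contDiff_shift D.k))

theorem injective_fderiv_joinStep_of_eqOn {g : E (p + 1) → E (c + (p + 1))}
    {s : Set (E (p + 1))} (hs : IsOpen s) (hx : x ∈ closure s) (heq : EqOn (joinStep D h f i) g s)
    (hg : ContDiff ℝ ∞ g) (hgx : Function.Injective (fderiv ℝ g x)) :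
    Function.Injective (fderiv ℝ (joinStep D h f i) x) := by
  rwa [fderiv_eqOn_closure ((D.contDiff_joinStep h hf i).of_le (by simp)) (hg.of_le (by simp)) hs
    heq hx]

theorem injective_fderiv_push_comp (j : Fin m) (x : E (p + 1)) :
    Function.Injective (fderiv ℝ (D.push h ∘ f j) x) :=
  injective_fderiv_comp ((D.contDiff_push h).differentiable (by simp) _)
    ((hf.smooth j).differentiable (by simp) _) (D.injective_fderiv_push h _) (hf.immersion j x)

theorem injective_fderiv_joinStep (x : E (p + 1)) :
    Function.Injective (fderiv ℝ (joinStep D h f i) x) := by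
  have hpushf (j : Fin m) : ContDiff ℝ ∞ (D.push h ∘ f j) :=
    (D.contDiff_push h).comp (hf.smooth j)
  have hshift : ContDiff ℝ ∞ (shift D.k : E (p + 1) → _) := contDiff_shift D.k
  by_cases hx : x ∈ closedCube _
  · exact D.injective_fderiv_joinStep_of_eqOn h hf i (isOpen_openBox _)
      ((closure_openBox fun _ => one_pos).symm ▸ hx)
      (fun y hy => if_pos (openBox_subset_closedBox hy)) (hpushf (keptIndex i))
      (D.injective_fderiv_push_comp h hf _ x)
  by_cases hmoved : (i : ℕ) + 1 = m - 1 ∧ shift D.k x ∈ closedCube _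
  · exact D.injective_fderiv_joinStep_of_eqOn h hf i (g := (D.push h ∘ f (lastIndex i)) ∘ shift D.k)
      ((isOpen_openBox _).preimage hshift.continuous)
      (D.closure_shift_preimage_openCube.symm ▸ hmoved.2)
      (fun y hy => (if_neg fun hy' => D.shift_notMem_openCube hy' hy).trans
        (if_pos ⟨hmoved.1, openBox_subset_closedBox hy⟩))
      ((hpushf _).comp hshift)
      (injective_fderiv_comp ((hpushf _).differentiable (by simp) _)
        (hshift.differentiable (by simp) _) (D.injective_fderiv_push_comp h hf _ _)
        (injective_fderiv_shift _ x))
  · have hopen : IsOpen {y | ¬ y ∈ closedCube _ ∧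
        ¬ ((i : ℕ) + 1 = m - 1 ∧ shift D.k y ∈ closedCube (p + 1))} :=
      (isClosed_closedBox _).not.and (isClosed_const.and
        ((isClosed_closedBox _).preimage hshift.continuous)).not
    exact D.injective_fderiv_joinStep_of_eqOn h hf i hopen (subset_closure ⟨hx, hmoved⟩)
      (fun y hy => (if_neg hy.1).trans (if_neg hy.2)) (contDiff_stdLink (keptIndex i))
      (injective_fderiv_stdLink (by omega) _ x)

end LongLink

end JoiningData

/-- The half-widths of the box `[-2k,2k] × [-1,1]^{p-1}` in `ℝ^p`. -/
def domainWidth (k : ℝ) {p : ℕ} (j : Fin p) : ℝ := if (j : ℕ) = 0 then 2 * k else 1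

namespace JoiningData

variable {m c n p : ℕ} (D : JoiningData m c)

theorem two_mul_k_pos : 0 < 2 * D.k := by linarith [D.two_lt_k]

theorem one_le_boxWidth (j : Fin n) : 1 ≤ boxWidth c D.k j := by
  unfold boxWidth
  split_ifs <;> linarith [D.two_lt_k]

theorem mapsTo_shrink : MapsTo (shrink c D.S (2 * D.k))
    (openBox (boxWidth c D.k) : Set (E n)) (openCube n) := by
  intro y hy j
  have hj := hy j
  simp only [shrink]
  unfold boxWidth at hj
  split_ifs at hj ⊢
  · exact abs_lt.2 (D.S_maps (abs_lt.1 hj))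
  · rwa [abs_div, abs_of_pos D.two_mul_k_pos, div_lt_one D.two_mul_k_pos]
  · exact hj

theorem mapsTo_stretch : MapsTo (stretch (2 * D.k))
    (openCube p) (openBox (domainWidth D.k) : Set (E p)) := by
  intro x hx j
  simp only [stretch, domainWidth]
  split_ifs
  · rw [abs_mul, abs_of_pos D.two_mul_k_pos]
    exact mul_lt_of_lt_one_right D.two_mul_k_pos (hx j)
  · exact hx j

theorem mem_openCube_of_stretch {x : E p} (hx : stretch (2 * D.k) x ∈ openCube p) :
    x ∈ openCube p := by
  intro j
  have hj := hx j
  simp only [stretch] at hj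
  split_ifs at hj
  · rw [abs_mul, abs_of_pos D.two_mul_k_pos] at hj
    nlinarith [D.two_lt_k, abs_nonneg (x j)]
  · exact hj

theorem mem_openCube_of_shift_stretch {x : E p}
    (hx : shift D.k (stretch (2 * D.k) x) ∈ openCube p) : x ∈ openCube p := by
  intro j
  have hj := hx j
  simp only [stretch, shift] at hj
  split_ifs at hj
  · rw [abs_lt] at hj ⊢
    constructor <;> nlinarith [D.two_lt_k]
  · exact hj

theorem shrink_stdLink_stretch (i : Fin (m - 1)) (x : E (p + 1)) :
    shrink c D.S (2 * D.k) (stdLink m (p + 1) (c + (p + 1)) (keptIndex i) (stretch (2 * D.k) x)) =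
      stdLink (m - 1) (p + 1) (c + (p + 1)) i x := by
  have hi := i.isLt
  have hk := D.two_mul_k_pos.ne'
  have hc := D.codim_ne_zero
  ext j
  rcases eq_or_ne (j : ℕ) 0 with hj | hj
  · simp [shrink, stdLink, hj, hc, D.S_std (i + 1) (by omega) (by omega), -Fin.val_eq_zero_iff]
  rcases lt_trichotomy (j : ℕ) c with hjc | hjc | hjc
  · simp [shrink, stdLink, hj, hjc.not_ge, -Fin.val_eq_zero_iff]
  · simp [shrink, stdLink, stretch, hjc, hc, mul_div_cancel_left₀ _ hk, -Fin.val_eq_zero_iff]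
  · have hjc' : (j : ℕ) + (p + 1) - (c + (p + 1)) ≠ 0 := by omega
    simp [shrink, stdLink, stretch, hj, hjc.le, hjc.not_ge, hjc', -Fin.val_eq_zero_iff]

section LongLink

variable (h : c + 1 ≤ c + (p + 1)) {f : Fin m → E (p + 1) → E (c + (p + 1))}
  (hf : IsLongLink m (p + 1) (c + (p + 1)) f)

theorem mapsTo_stdLink (i : Fin m) : MapsTo (stdLink m (p + 1) (c + (p + 1)) i)
    (openBox (domainWidth D.k)) (openBox (boxWidth c D.k)) := by
  intro x hx j
  simp only [stdLink]
  split_ifs with hj h0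
  · refine (hx _).trans_le ?_
    have := D.codim_ne_zero
    simp only [domainWidth, boxWidth]
    split_ifs <;> first | rfl | omega
  · exact (abs_tstar_lt_one (by omega) i.isLt).trans_le (D.one_le_boxWidth j)
  · rw [abs_zero]
    linarith [D.one_le_boxWidth j]

include hf

theorem mapsTo_openBox_of_isLongLink (i : Fin m) :
    MapsTo (f i) (openBox (domainWidth D.k)) (openBox (boxWidth c D.k)) := by
  intro x hx
  by_cases hx' : x ∈ openCube _
  · exact fun j => (hf.cube i x hx' j).trans_le (D.one_le_boxWidth j)
  · rw [hf.std i x hx']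
    exact D.mapsTo_stdLink i hx

theorem mapsTo_joinStep (i : Fin (m - 1)) :
    MapsTo (joinStep D h f i) (openBox (domainWidth D.k)) (openBox (boxWidth c D.k)) := by
  intro x hx
  unfold joinStep
  split_ifs with hcube hmoved
  · exact D.mapsTo_push_openBox h (D.mapsTo_openBox_of_isLongLink hf _ hx)
  · refine D.mapsTo_push_openBox h (D.mapsTo_openBox_of_isLongLink hf _ fun j => ?_)
    by_cases hj : (j : ℕ) = 0
    · rw [domainWidth, if_pos hj]
      linarith [hmoved.2 j, D.two_lt_k]
    · simpa only [shift, hj, if_false] using hx j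
  · exact D.mapsTo_stdLink _ hx

theorem push_ne_stdLink_of_notMem {j : Fin m} {y x : E (p + 1)} (hy : y ∈ closedCube _)
    {i : Fin (m - 1)} (hx : x ∉ closedCube _)
    (hx' : ¬ ((i : ℕ) + 1 = m - 1 ∧ shift D.k x ∈ closedCube _)) :
    D.push h (f j y) ≠ stdLink m _ _ (keptIndex i) x := fun he =>
  (D.of_push_eq_stdLink h (hf.mem_closedCube j hy) (by simp) he).elim hx hx'

theorem joinStep_sigma_injective :
    Function.Injective fun q : (_ : Fin (m - 1)) × E (p + 1) => joinStep D h f q.1 q.2 := by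
  have hpush {j j' : Fin m} {y y' : E (p + 1)} (he : D.push h (f j y) = D.push h (f j' y')) :
      (j : ℕ) = j' ∧ y = y' := by
    have := @hf.embedding.injective ⟨j, y⟩ ⟨j', y'⟩ (D.push_injective h he)
    simpa [Fin.ext_iff] using this
  rintro ⟨i, x⟩ ⟨i', x'⟩ he
  suffices (i : ℕ) = i' ∧ x = x' by simpa [Fin.ext_iff] using this
  have hi := i.isLt
  have hi' := i'.isLt
  simp only [joinStep] at he
  split_ifs at he with hx hx' hlast' hlast hx' hlast' hx' hlast'
  · exact hpush he
  · have := (hpush he).1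
    simp only [Fin.val_castLE] at this
    omega
  · exact absurd he (D.push_ne_stdLink_of_notMem h hf hx hx' hlast')
  · have := (hpush he).1
    simp only [Fin.val_castLE] at this
    omega
  · exact ⟨by omega, D.shift_k_injective (hpush he).2⟩
  · exact absurd he (D.push_ne_stdLink_of_notMem h hf hlast.2 hx' hlast')
  · exact absurd he.symm (D.push_ne_stdLink_of_notMem h hf hx' hx hlast)
  · exact absurd he.symm (D.push_ne_stdLink_of_notMem h hf hlast'.2 hx hlast)
  · simpa [Fin.ext_iff] using
      stdLink_sigma_injective D.codim_ne_zero (a₁ := ⟨_, x⟩) (a₂ := ⟨_, x'⟩) he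

theorem joinFun_eq_glue (i : Fin (m - 1)) (x : E (p + 1)) :
    joinFun D h f i x = shrink c D.S (2 * D.k) (D.glue h i (stretch (2 * D.k) x)
      (f (keptIndex i) (stretch (2 * D.k) x))
      (f (lastIndex i) (shift D.k (stretch (2 * D.k) x)))) := by
  rw [joinFun, D.joinStep_eq_glue h hf]

theorem joinFun_of_eq_std {i : Fin (m - 1)} {x : E (p + 1)}
    (hkept : f (keptIndex i) (stretch (2 * D.k) x) =
      stdLink m _ _ (keptIndex i) (stretch (2 * D.k) x))
    (hlast : f (lastIndex i) (shift D.k (stretch (2 * D.k) x)) =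
      stdLink m _ _ (lastIndex i) (shift D.k (stretch (2 * D.k) x))) :
    joinFun D h f i x = stdLink (m - 1) _ _ i x := by
  rw [D.joinFun_eq_glue h hf, glue, hkept, hlast]
  simp only [sub_self, add_zero, ite_self, D.shrink_stdLink_stretch]

theorem contDiff_joinFun (i : Fin (m - 1)) : ContDiff ℝ ∞ (joinFun D h f i) :=
  (contDiff_shrink D.S_smooth).comp ((D.contDiff_joinStep h hf i).comp (contDiff_stretch _))

theorem injective_fderiv_joinFun (i : Fin (m - 1)) (x : E (p + 1)) :
    Function.Injective (fderiv ℝ (joinFun D h f i) x) := by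
  have hk := D.two_mul_k_pos.ne'
  have hstep := D.contDiff_joinStep h hf i
  have hstretch : ContDiff ℝ ∞ (stretch (2 * D.k) : E (p + 1) → _) := contDiff_stretch _
  exact injective_fderiv_comp ((contDiff_shrink D.S_smooth).differentiable (by simp) _)
    ((hstep.comp hstretch).differentiable (by simp) _)
    (injective_fderiv_shrink (fun t => (D.S_deriv t).ne') hk _)
    (injective_fderiv_comp (hstep.differentiable (by simp) _)
      (hstretch.differentiable (by simp) _) (D.injective_fderiv_joinStep h hf i _)
      (injective_fderiv_stretch hk x))

theorem joinFun_sigma_injective :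
    Function.Injective fun q : (_ : Fin (m - 1)) × E (p + 1) => joinFun D h f q.1 q.2 := by
  have hk := D.two_mul_k_pos.ne'
  rintro ⟨i, x⟩ ⟨i', x'⟩ he
  have hstep := @joinStep_sigma_injective m c p D h f hf ⟨i, _⟩ ⟨i', _⟩
    (shrink_injective D.S_injective hk he)
  simp only [Sigma.mk.injEq, heq_eq_eq] at hstep ⊢
  exact ⟨hstep.1, (stretch_leftInverse hk).injective hstep.2⟩

theorem joinFun_of_notMem_openCube (i : Fin (m - 1)) {x : E (p + 1)} (hx : x ∉ openCube _) :
    joinFun D h f i x = stdLink (m - 1) _ _ i x :=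
  D.joinFun_of_eq_std h hf (hf.std _ _ fun hx' => hx (D.mem_openCube_of_stretch hx'))
    (hf.std _ _ fun hx' => hx (D.mem_openCube_of_shift_stretch hx'))

theorem isLongLink_joinFun : IsLongLink (m - 1) (p + 1) (c + (p + 1)) (joinFun D h f) where
  smooth := D.contDiff_joinFun h hf
  immersion := D.injective_fderiv_joinFun h hf
  embedding := isEmbedding_of_eqOn_std (by omega) (fun i => (D.contDiff_joinFun h hf i).continuous)
    (fun i _ hx => D.joinFun_of_notMem_openCube h hf i fun hx' => hx (openBox_subset_closedBox hx'))
    (D.joinFun_sigma_injective h hf)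
  cube i _ hx := D.mapsTo_shrink (D.mapsTo_joinStep h hf i (D.mapsTo_stretch hx))
  std i _ hx := D.joinFun_of_notMem_openCube h hf i hx

end LongLink

end JoiningData

/-! ### Joining links and loops of links -/

namespace JoiningData

variable {m c p : ℕ} (D : JoiningData m c) (h : c + 1 ≤ c + (p + 1)) (i : Fin (m - 1))

/-- The dependence of the join at `x` on `stretch (2k) x` and on the two values of the link that
are used there. -/
def joinKernel : SmoothMap (E (p + 1) × E (c + (p + 1)) × E (c + (p + 1))) (E (c + (p + 1))) :=
  ⟨fun q => shrink c D.S (2 * D.k) (D.glue h i q.1 q.2.1 q.2.2),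
    (contDiff_shrink D.S_smooth).comp (D.contDiff_glue h i)⟩

/-- The map `2k × 1_{p-1}`. -/
def stretchMap (p : ℕ) : SmoothMap (E p) (E p) := ⟨stretch (2 * D.k), contDiff_stretch _⟩

/-- The translation `T`. -/
def shiftMap (p : ℕ) : SmoothMap (E p) (E p) := ⟨shift D.k, contDiff_shift _⟩

theorem continuous_joinKernel_comp {X : Type*} {V : Type} [TopologicalSpace X]
    [NormedAddCommGroup V] [NormedSpace ℝ V] [LocallyCompactSpace V] (x : SmoothMap V (E (p + 1)))
    {Y Z : X → SmoothMap V (E (c + (p + 1)))} (hY : Continuous Y) (hZ : Continuous Z) :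
    Continuous fun f => (D.joinKernel h i).comp (x.prodMk ((Y f).prodMk (Z f))) :=
  SmoothMap.continuous_comp continuous_const <|
    SmoothMap.continuous_prodMk continuous_const (SmoothMap.continuous_prodMk hY hZ)

/-- The joining map. -/
def join (f : LongLink m (p + 1) (c + (p + 1))) : LongLink (m - 1) (p + 1) (c + (p + 1)) :=
  ⟨joinFun D h f.toFun, D.isLongLink_joinFun h f.isLongLink⟩

theorem component_join (f : LongLink m (p + 1) (c + (p + 1))) :
    (D.join h f).component i = (D.joinKernel h i).comp ((D.stretchMap _).prodMk
      (((f.component (keptIndex i)).comp (D.stretchMap _)).prodMk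
        ((f.component (lastIndex i)).comp ((D.shiftMap _).comp (D.stretchMap _))))) :=
  SmoothMap.ext <| funext (D.joinFun_eq_glue h f.isLongLink i)

theorem continuous_join : Continuous (D.join h : LongLink m (p + 1) (c + (p + 1)) → _) := by
  refine LongLink.continuous_of_component fun i => ?_
  simp only [D.component_join h]
  exact D.continuous_joinKernel_comp h i _
    (SmoothMap.continuous_comp (LongLink.continuous_component _) continuous_const)
    (SmoothMap.continuous_comp (LongLink.continuous_component _) continuous_const)

/-- The components of the join of a loop. -/
def loopJoinComponent (l : LoopLink m (p + 1) (c + (p + 1))) :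
    SmoothMap (ℝ × E (p + 1)) (E (c + (p + 1))) :=
  let time : SmoothMap (ℝ × E (p + 1)) ℝ := ⟨Prod.fst, contDiff_fst⟩
  let x := (D.stretchMap (p + 1)).comp ⟨(Prod.snd : ℝ × _ → _), contDiff_snd⟩
  (D.joinKernel h i).comp (x.prodMk
    (((l.component (keptIndex i)).comp (time.prodMk x)).prodMk
      ((l.component (lastIndex i)).comp (time.prodMk ((D.shiftMap _).comp x)))))

theorem continuous_loopJoinComponent : Continuous (D.loopJoinComponent h i) :=
  D.continuous_joinKernel_comp h i _
    (SmoothMap.continuous_comp (LoopLink.continuous_component _) continuous_const)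
    (SmoothMap.continuous_comp (LoopLink.continuous_component _) continuous_const)

theorem loopJoinComponent_toFun (l : LoopLink m (p + 1) (c + (p + 1))) :
    (D.loopJoinComponent h i l).toFun = fun q => joinFun D h (l.link q.1).toFun i q.2 :=
  funext fun q => (D.joinFun_eq_glue h (l.link q.1).isLongLink i q.2).symm

/-- The map that joins the links of a loop. -/
def loopJoin (l : LoopLink m (p + 1) (c + (p + 1))) : LoopLink (m - 1) (p + 1) (c + (p + 1)) where
  link t := D.join h (l.link t)
  smooth i := D.loopJoinComponent_toFun h i l ▸ (D.loopJoinComponent h i l).smooth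
  based t ht := by
    have hl := l.based t ht
    funext i x
    exact D.joinFun_of_eq_std h (l.link t).isLongLink (by rw [hl]) (by rw [hl])

theorem continuous_loopJoin :
    Continuous (D.loopJoin h : LoopLink m (p + 1) (c + (p + 1)) → _) := by
  refine LoopLink.continuous_of_component fun i => ?_
  have hcomponent (l : LoopLink m (p + 1) (c + (p + 1))) :
      (D.loopJoin h l).component i = D.loopJoinComponent h i l :=
    SmoothMap.ext (D.loopJoinComponent_toFun h i l).symm
  simp only [hcomponent]
  exact D.continuous_loopJoinComponent h i

end JoiningData

/-! ### Graphing -/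

/-- The identification of `ℝ^{n+1}` with `ℝ × ℝ^n` that splits off the last coordinate. -/
def splitLast (n : ℕ) : E (n + 1) ≃L[ℝ] ℝ × E n :=
  LinearEquiv.toContinuousLinearEquiv
    { toFun := fun x => (x (Fin.last n), WithLp.toLp 2 fun j : Fin n => x j.castSucc)
      invFun := fun q => WithLp.toLp 2 (Fin.snoc (α := fun _ => ℝ) q.2 q.1)
      map_add' := fun _ _ => rfl
      map_smul' := fun _ _ => rfl
      left_inv := fun x => by
        ext j
        induction j using Fin.lastCases <;> simp
      right_inv := fun q => by ext <;> simp }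

theorem mem_openCube_succ {n : ℕ} {x : E (n + 1)} :
    x ∈ openCube (n + 1) ↔ |(splitLast n x).1| < 1 ∧ (splitLast n x).2 ∈ openCube n :=
  Fin.forall_fin_succ'.trans and_comm

@[simp] theorem splitLast_fst {n : ℕ} (x : E (n + 1)) : (splitLast n x).1 = x (Fin.last n) := rfl

@[simp] theorem splitLast_snd_apply {n : ℕ} (x : E (n + 1)) (j : Fin n) :
    (splitLast n x).2 j = x j.castSucc := rfl

section Graph

variable {m p n : ℕ} (i : Fin m)

theorem splitLast_stdLink (x : E (p + 1)) : splitLast n (stdLink m (p + 1) (n + 1) i x) =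
    ((splitLast p x).1, stdLink m p n i (splitLast p x).2) := by
  refine Prod.ext ?_ (PiLp.ext fun j => ?_)
  · have hn : n + (p + 1) - (n + 1) = p := by omega
    simp [stdLink, hn, Fin.last]
  · have hj : n + 1 ≤ (j : ℕ) + (p + 1) ↔ n ≤ (j : ℕ) + p := by omega
    have hj' : (j : ℕ) + (p + 1) - (n + 1) = j + p - n := by omega
    simp only [splitLast_snd_apply, stdLink, Fin.val_castSucc, hj, hj', Fin.castSucc_mk]

variable (l : LoopLink m p n)

theorem splitLast_graphFun (x : E (p + 1)) : splitLast n (graphFun l i x) =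
    ((splitLast p x).1, (l.link (splitLast p x).1).toFun i (splitLast p x).2) :=
  (splitLast n).apply_symm_apply
    ((splitLast p x).1, (l.link (splitLast p x).1).toFun i (splitLast p x).2)

theorem graphFun_eq_comp : graphFun l i =
    (splitLast n).symm ∘ (fun q => (q.1, (l.link q.1).toFun i q.2)) ∘ splitLast p :=
  rfl

theorem contDiff_graphFun : ContDiff ℝ ∞ (graphFun l i) :=
  (splitLast n).symm.contDiff.comp <|
    (contDiff_fst.prodMk (l.smooth i)).comp (splitLast p).contDiff

theorem injective_fderiv_graphFun (x : E (p + 1)) :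
    Function.Injective (fderiv ℝ (graphFun l i) x) := by
  have hgraph : Function.Injective
      (fderiv ℝ (fun q => (q.1, (l.link q.1).toFun i q.2)) (splitLast p x)) :=
    injective_fderiv_graph ((l.smooth i).differentiable (by simp))
      ((l.link _).isLongLink.immersion i _)
  rw [graphFun_eq_comp, ContinuousLinearEquiv.comp_fderiv, ContinuousLinearEquiv.comp_right_fderiv]
  exact (splitLast n).symm.injective.comp (hgraph.comp (splitLast p).injective)

theorem graphFun_sigma_injective :
    Function.Injective fun q : (_ : Fin m) × E (p + 1) => graphFun l q.1 q.2 := by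
  rintro ⟨i, x⟩ ⟨i', x'⟩ he
  have hsplit := congrArg (splitLast n) he
  simp only [splitLast_graphFun, Prod.mk.injEq] at hsplit
  obtain ⟨hlast, hinit⟩ := hsplit
  rw [hlast] at hinit
  have hlink := @(l.link _).isLongLink.embedding.injective ⟨i, _⟩ ⟨i', _⟩ hinit
  simp only [Sigma.mk.injEq, heq_eq_eq] at hlink ⊢
  exact ⟨hlink.1, (splitLast p).injective (Prod.ext hlast hlink.2)⟩

theorem LoopLink.eq_std_of_one_le_abs {t : ℝ} (ht : 1 ≤ |t|) (x : E p) :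
    (l.link t).toFun i x = stdLink m p n i x := by
  have hbased : EqOn (fun t => (l.link t).toFun i x) (fun _ => stdLink m p n i x) (Icc (-1) 1)ᶜ :=
    fun t ht => congrFun (congrFun (l.based t ht) i) x
  refine hbased.closure ((l.smooth i).continuous.comp (.prodMk_left x)) continuous_const ?_
  rw [closure_compl, interior_Icc]
  exact fun hmem => ht.not_gt (abs_lt.2 hmem)

theorem graphFun_of_notMem_openCube {x : E (p + 1)} (hx : x ∉ openCube _) :
    graphFun l i x = stdLink m (p + 1) (n + 1) i x := by
  refine (splitLast n).injective ?_
  rw [splitLast_graphFun, splitLast_stdLink]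
  congr 1
  by_cases ht : |(splitLast p x).1| < 1
  · exact (l.link _).isLongLink.std i _ fun hinit => hx (mem_openCube_succ.2 ⟨ht, hinit⟩)
  · exact l.eq_std_of_one_le_abs i (not_lt.1 ht) _

theorem isLongLink_graphFun (hpn : p ≤ n) : IsLongLink m (p + 1) (n + 1) (graphFun l) where
  smooth i := contDiff_graphFun i l
  immersion i := injective_fderiv_graphFun i l
  embedding := isEmbedding_of_eqOn_std (by omega) (fun i => (contDiff_graphFun i l).continuous)
    (fun i _ hx => graphFun_of_notMem_openCube i l fun hx' => hx (openBox_subset_closedBox hx'))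
    (graphFun_sigma_injective l)
  cube i x hx := by
    obtain ⟨hlast, hinit⟩ := mem_openCube_succ.1 hx
    refine mem_openCube_succ.2 ?_
    rw [splitLast_graphFun]
    exact ⟨hlast, (l.link _).isLongLink.cube i _ hinit⟩
  std i _ hx := graphFun_of_notMem_openCube i l hx

/-- The graphing map. -/
def graph (hpn : p ≤ n) (l : LoopLink m p n) : LongLink m (p + 1) (n + 1) :=
  ⟨graphFun l, isLongLink_graphFun l hpn⟩

theorem continuous_graph (hpn : p ≤ n) : Continuous (graph hpn : LoopLink m p n → _) := by
  refine LongLink.continuous_of_component fun i => ?_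
  let time : SmoothMap (ℝ × E p) ℝ := ⟨Prod.fst, contDiff_fst⟩
  let split : SmoothMap (E (p + 1)) (ℝ × E p) := ⟨splitLast p, (splitLast p).contDiff⟩
  let unsplit : SmoothMap (ℝ × E n) (E (n + 1)) := ⟨_, (splitLast n).symm.contDiff⟩
  have hcomponent (l : LoopLink m p n) : (graph hpn l).component i =
      unsplit.comp ((time.prodMk (l.component i)).comp split) := rfl
  simp only [hcomponent]
  exact SmoothMap.continuous_comp continuous_const <| SmoothMap.continuous_comp
    (SmoothMap.continuous_prodMk continuous_const (LoopLink.continuous_component i))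
    continuous_const

end Graph

/-! ### Joining commutes with graphing -/

section SplitLast

variable {a c n p : ℕ}

theorem splitLast_prodId (h : a ≤ n) (h' : a ≤ n + 1) (φ : E a → E a) (y : E (n + 1)) :
    splitLast n (prodId h' φ y) = ((splitLast n y).1, prodId h φ (splitLast n y).2) :=
  Prod.ext (prodId_apply_of_le h' φ y h) rfl

theorem splitLast_shrink (h : c + 1 ≤ n) (S : ℝ → ℝ) (r : ℝ) (y : E (n + 1)) :
    splitLast n (shrink c S r y) = ((splitLast n y).1, shrink c S r (splitLast n y).2) := by
  refine Prod.ext ?_ rfl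
  have hn : n ≠ 0 := by omega
  have hnc : ¬ n < c + 1 := by omega
  simp only [splitLast_fst, shrink, Fin.val_last, hn, hnc, if_false]

theorem splitLast_shift (k : ℝ) (x : E (p + 1 + 1)) : splitLast (p + 1) (shift k x) =
    ((splitLast (p + 1) x).1, shift k (splitLast (p + 1) x).2) :=
  rfl

theorem splitLast_stretch (r : ℝ) (x : E (p + 1 + 1)) : splitLast (p + 1) (stretch r x) =
    ((splitLast (p + 1) x).1, stretch r (splitLast (p + 1) x).2) :=
  rfl

end SplitLast

namespace JoiningData

variable {m c p n : ℕ} (D : JoiningData m c)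

theorem splitLast_glue_graphFun (h : c + 1 ≤ n) (h' : c + 1 ≤ n + 1) (i : Fin (m - 1))
    (l : LoopLink m (p + 1) n) (x : E (p + 1 + 1)) :
    splitLast n (D.glue h' i x (graphFun l (keptIndex i) x)
      (graphFun l (lastIndex i) (shift D.k x))) =
    ((splitLast _ x).1, D.glue h i (splitLast _ x).2
      ((l.link (splitLast _ x).1).toFun (keptIndex i) (splitLast _ x).2)
      ((l.link (splitLast _ x).1).toFun (lastIndex i) (shift D.k (splitLast _ x).2))) := by
  have hpush (w : E (n + 1)) :
      splitLast n (D.push h' w) = ((splitLast n w).1, D.push h (splitLast n w).2) :=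
    splitLast_prodId h h' (D.φ 1) w
  unfold glue
  split_ifs <;> simp only [map_add, map_sub, hpush, splitLast_stdLink, splitLast_graphFun,
    splitLast_shift, Prod.mk_sub_mk, Prod.mk_add_mk, sub_self, add_zero]

theorem joinFun_graphFun (h : c + 1 ≤ c + (p + 1)) (h' : c + 1 ≤ c + (p + 1) + 1)
    (l : LoopLink m (p + 1) (c + (p + 1))) :
    joinFun D h' (graphFun l) = graphFun (D.loopJoin h l) := by
  funext i x
  refine (splitLast _).injective ?_
  rw [D.joinFun_eq_glue h' (isLongLink_graphFun l (by omega)) i x, splitLast_shrink h,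
    D.splitLast_glue_graphFun h h', splitLast_stretch, splitLast_graphFun]
  exact congrArg (Prod.mk _) (D.joinFun_eq_glue h (l.link _).isLongLink i _).symm

end JoiningData

end LongLinks

end

open LongLinks in
theorem propositionP (m p n : ℕ) (hm : 2 ≤ m) (hp : 1 ≤ p) (hpn : p + 2 ≤ n)
    (D : JoiningData m (n - p)) :
    ∃ (J : C(LongLink m p n, LongLink (m - 1) p n))
      (J' : C(LongLink m (p + 1) (n + 1), LongLink (m - 1) (p + 1) (n + 1)))
      (ΩJ : C(LoopLink m p n, LoopLink (m - 1) p n))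
      (G : C(LoopLink m p n, LongLink m (p + 1) (n + 1)))
      (G' : C(LoopLink (m - 1) p n, LongLink (m - 1) (p + 1) (n + 1))),
      (∀ f, (J f).toFun = joinFun D (by omega) f.toFun) ∧
      (∀ f, (J' f).toFun = joinFun D (by omega) f.toFun) ∧
      (∀ l t, (ΩJ l).link t = J (l.link t)) ∧
      (∀ l, (G l).toFun = graphFun l) ∧
      (∀ l, (G' l).toFun = graphFun l) ∧
      J'.comp G = G'.comp ΩJ ∧
      ContinuousMap.Homotopic (J'.comp G) (G'.comp ΩJ) := by
  obtain ⟨q, rfl⟩ : ∃ q, p = q + 1 := ⟨p - 1, by omega⟩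
  generalize_proofs h h'
  generalize hc : n - (q + 1) = c at D h h'
  obtain rfl : n = c + (q + 1) := by omega
  let J : C(LongLink m (q + 1) _, LongLink (m - 1) (q + 1) _) := ⟨_, D.continuous_join h⟩
  let J' : C(LongLink m (q + 2) _, LongLink (m - 1) (q + 2) _) := ⟨_, D.continuous_join h'⟩
  let ΩJ : C(LoopLink m (q + 1) _, LoopLink (m - 1) (q + 1) _) := ⟨_, D.continuous_loopJoin h⟩
  let G (m : ℕ) : C(LoopLink m (q + 1) (c + (q + 1)), LongLink m _ _) :=
    ⟨_, continuous_graph (by omega)⟩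
  have hcomm : J'.comp (G m) = (G (m - 1)).comp ΩJ := by
    ext l
    exact LongLink.ext (D.joinFun_graphFun h h' l)
  refine ⟨J, J', ΩJ, G m, G (m - 1), fun _ => rfl, fun _ => rfl, fun _ _ => rfl, fun _ => rfl,
    fun _ => rfl, hcomm, ?_⟩
  rw [hcomm]
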